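/- For $m,n\in\mathbb{N}=\{0,1,2,\dots\}$ let $s(m,n)$ denote the number of partitions of $n$ into exactly $m$ positive parts such that any two parts differ by at least $3$, and any two parts that are both multiples of $3$ differ by at least $6$ (the empty partition is the only partition of $0$, so $s(0,0)=1$). For $k\ge 0$ write $(a;q)_k=\prod_{j=1}^{k}(1-aq^{j-1})$. Then, as formal power series in $x$ and $q$, \[ \sum_{m,n\ge 0} s(m,n)\,x^m q^n =\sum_{n_1,\,n_{21},\,n_{22}\ge 0} \frac{q^{\,6n_{21}^2-n_{21}+6n_{22}^2+n_{22}+2n_1^2-n_1+12n_{21}n_{22}+6(n_{21}+n_{22})n_1}\;x^{\,2n_{21}+2n_{22}+n_1}} {(q;q)_{n_1}\,(q^6;q^6)_{n_{21}}\,(q^6;q^6)_{n_{22}}}. \] -/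

import Mathlib

open scoped MvPowerSeries.WithPiTopology

noncomputable section

namespace SchurSeries

/-- Two parts `a`, `b` are compatible if they differ by at least `3`, and by at least `6` when both
are multiples of `3`. -/
def Compatible (a b : ℕ) : Prop :=
  3 ≤ |(a : ℤ) - b| ∧ (3 ∣ a → 3 ∣ b → 6 ≤ |(a : ℤ) - b|)

/-- A partition (into positive parts) any two of whose parts are compatible. The parts are counted
with multiplicity, so that a repeated part is excluded. -/
def IsSchur {n : ℕ} (p : n.Partition) : Prop :=
  p.parts.Pairwise Compatible

/-- `s m n` is the number of partitions of `n` into `m` positive parts that are pairwise at least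
`3` apart and whose multiples of `3` are pairwise at least `6` apart. -/
def s (m n : ℕ) : ℕ :=
  Nat.card {p : n.Partition // p.parts.card = m ∧ IsSchur p}

/-- The ring `ℤ⟦x, q⟧` of formal power series in two variables. Its topology is that of
coefficientwise convergence, `ℤ` being discrete: in a convergent sum every coefficient receives
only finitely many nonzero contributions. -/
abbrev Series : Type := MvPowerSeries (Fin 2) ℤ

/-- The variable `x`, which marks the number of parts. -/
def x : Series := MvPowerSeries.X 0

/-- The variable `q`, which marks the weight. -/
def q : Series := MvPowerSeries.X 1

/-- The `q`-Pochhammer symbol `(a; b)_n = ∏_{j = 1}^{n} (1 - a b^{j - 1})`. -/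
def poch (a b : Series) (n : ℕ) : Series :=
  ∏ j ∈ Finset.range n, (1 - a * b ^ j)

/-- The exponent `6 a ^ 2 - a + 6 b ^ 2 + b + 2 c ^ 2 - c + 12 a b + 6 (a + b) c`,
for `a = n₂₁`, `b = n₂₂`, `c = n₁`. -/
def expo (a b c : ℕ) : ℕ :=
  6 * a ^ 2 - a + 6 * b ^ 2 + b + (2 * c ^ 2 - c) + 12 * a * b + 6 * (a + b) * c

/-- No subtraction in `expo` is truncated. -/
theorem expo_cast (a b c : ℕ) :
    (expo a b c : ℤ) = 6 * (a : ℤ) ^ 2 - a + 6 * (b : ℤ) ^ 2 + b + 2 * (c : ℤ) ^ 2 - c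
      + 12 * a * b + 6 * (a + b) * c := by
  have ha : a ≤ 6 * a ^ 2 := by nlinarith [Nat.le_self_pow (two_ne_zero) a]
  have hc : c ≤ 2 * c ^ 2 := by nlinarith [Nat.le_self_pow (two_ne_zero) c]
  unfold expo
  push_cast [Nat.cast_sub ha, Nat.cast_sub hc]
  ring

/-- The denominators are invertible, so `Ring.inverse` below is a genuine inverse. -/
theorem isUnit_poch (k : ℕ) (hk : k ≠ 0) (n : ℕ) : IsUnit (poch (q ^ k) (q ^ k) n) := by
  rw [MvPowerSeries.isUnit_iff_constantCoeff]
  simp [poch, q, map_prod, hk]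

/-- The general term of the triple series, for `n₂₁ = a`, `n₂₂ = b`, `n₁ = c`. -/
def term (c a b : ℕ) : Series :=
  q ^ expo a b c * x ^ (2 * a + 2 * b + c) *
    Ring.inverse (poch q q c * poch (q ^ 6) (q ^ 6) a * poch (q ^ 6) (q ^ 6) b)

end SchurSeries

end

noncomputable section

namespace SchurSeries

/-! Fix the number m of parts and let k bound the parts from below. Splitting on whether k + 1 is a
part gives G(k, m+1) = G(k+1, m+1) + q^(k+1) G(k', m), where k' is `nextBound k`. The weighted
triple series `tailSum` obeys the same recurrence (`tailSum_succ`), a consequence of three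
q-difference equations, one per summation index.

By induction on m, the difference of the two sides at m + 1 does not depend on k. Both sides are
divisible by powers of q that grow with k, so the difference is 0 (`tailGen_eq_tailSum`). The
theorem is the case k = 0, summed against x^m. -/

theorem expo_succ_right (a b c : ℕ) :
    expo a b (c + 1) = expo a b c + (4 * c + 6 * a + 6 * b + 1) := by
  zify
  rw [expo_cast, expo_cast]
  push_cast
  ring

theorem expo_succ_left (a b c : ℕ) :
    expo (a + 1) b c = expo a b c + (12 * a + 12 * b + 6 * c + 5) := by
  zify
  rw [expo_cast, expo_cast]
  push_cast
  ring

theorem expo_succ_mid (a b c : ℕ) :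
    expo a (b + 1) c = expo a b c + (12 * a + 12 * b + 6 * c + 7) := by
  zify
  rw [expo_cast, expo_cast]
  push_cast
  ring

/-- The inverse of the denominator of the general term, for `c = n₁`, `a = n₂₁`, `b = n₂₂`. -/
def invDen (c a b : ℕ) : Series :=
  Ring.inverse (poch q q c * poch (q ^ 6) (q ^ 6) a * poch (q ^ 6) (q ^ 6) b)

theorem isUnit_poch_one (n : ℕ) : IsUnit (poch q q n) := by
  simpa using isUnit_poch 1 one_ne_zero n

theorem isUnit_poch_six (n : ℕ) : IsUnit (poch (q ^ 6) (q ^ 6) n) :=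
  isUnit_poch 6 (by norm_num) n

theorem poch_succ (a b : Series) (n : ℕ) : poch a b (n + 1) = poch a b n * (1 - a * b ^ n) :=
  Finset.prod_range_succ _ _

theorem inverse_mul_right_cancel {R : Type*} [CommRing R] {u v : R} (h : IsUnit (u * v)) :
    Ring.inverse (u * v) * v = Ring.inverse u := by
  rw [Ring.mul_inverse_rev, mul_right_comm, Ring.inverse_mul_cancel _ (isUnit_of_mul_isUnit_right h),
    one_mul]

theorem isUnit_den (c a b : ℕ) :
    IsUnit (poch q q c * poch (q ^ 6) (q ^ 6) a * poch (q ^ 6) (q ^ 6) b) :=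
  ((isUnit_poch_one c).mul (isUnit_poch_six a)).mul (isUnit_poch_six b)

theorem invDen_succ_one (c a b : ℕ) : invDen (c + 1) a b * (1 - q ^ (c + 1)) = invDen c a b := by
  have h : poch q q (c + 1) * poch (q ^ 6) (q ^ 6) a * poch (q ^ 6) (q ^ 6) b =
      (poch q q c * poch (q ^ 6) (q ^ 6) a * poch (q ^ 6) (q ^ 6) b) * (1 - q ^ (c + 1)) := by
    rw [poch_succ]; ring
  have hu := isUnit_den (c + 1) a b
  rw [h] at hu
  rw [invDen, h, inverse_mul_right_cancel hu, invDen]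

theorem invDen_succ_two (c a b : ℕ) :
    invDen c (a + 1) b * (1 - q ^ (6 * (a + 1))) = invDen c a b := by
  have h : poch q q c * poch (q ^ 6) (q ^ 6) (a + 1) * poch (q ^ 6) (q ^ 6) b =
      (poch q q c * poch (q ^ 6) (q ^ 6) a * poch (q ^ 6) (q ^ 6) b) *
        (1 - q ^ (6 * (a + 1))) := by
    rw [poch_succ]; ring
  have hu := isUnit_den c (a + 1) b
  rw [h] at hu
  rw [invDen, h, inverse_mul_right_cancel hu, invDen]

theorem invDen_succ_three (c a b : ℕ) :
    invDen c a (b + 1) * (1 - q ^ (6 * (b + 1))) = invDen c a b := by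
  have h : poch q q c * poch (q ^ 6) (q ^ 6) a * poch (q ^ 6) (q ^ 6) (b + 1) =
      (poch q q c * poch (q ^ 6) (q ^ 6) a * poch (q ^ 6) (q ^ 6) b) *
        (1 - q ^ (6 * (b + 1))) := by
    rw [poch_succ]; ring
  have hu := isUnit_den c a (b + 1)
  rw [h] at hu
  rw [invDen, h, inverse_mul_right_cancel hu, invDen]

/-! ### q-difference equations of the triple series -/

/-- The triples `(c, a, b)` with `2 a + 2 b + c = m`. -/
def triples (m : ℕ) : Finset (ℕ × ℕ × ℕ) :=
  (Finset.range (m + 1) ×ˢ Finset.range (m + 1) ×ˢ Finset.range (m + 1)).filter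
    fun t => 2 * t.2.1 + 2 * t.2.2 + t.1 = m

@[simp]
theorem mem_triples {m : ℕ} {t : ℕ × ℕ × ℕ} :
    t ∈ triples m ↔ 2 * t.2.1 + 2 * t.2.2 + t.1 = m := by
  simp only [triples, Finset.mem_filter, Finset.mem_product, Finset.mem_range]
  omega

/-- The general term without its power of `x`, weighted by `q ^ (i a + k b + j c)`. -/
def summand (i k j : ℕ) (t : ℕ × ℕ × ℕ) : Series :=
  q ^ (expo t.2.1 t.2.2 t.1 + i * t.2.1 + k * t.2.2 + j * t.1) * invDen t.1 t.2.1 t.2.2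

/-- The coefficient of `x ^ m` in the weighted triple series. -/
def tripleSum (i k j m : ℕ) : Series :=
  ∑ t ∈ triples m, summand i k j t

/-- Raising j by 1 multiplies a term by q^c. The difference thus carries 1 - q^c, which cancels the
last factor of (q;q)_c; then c is shifted by 1. The two analogues below do this for a and b. -/
theorem tripleSum_sub_one (i k j m : ℕ) :
    tripleSum i k j (m + 1) - tripleSum i k (j + 1) (m + 1) =
      q ^ (j + 1) * tripleSum (i + 6) (k + 6) (j + 4) m := by
  rw [tripleSum, tripleSum, tripleSum, ← Finset.sum_sub_distrib, Finset.mul_sum]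
  symm
  refine Finset.sum_of_injOn (fun t => (t.1 + 1, t.2)) ?_ ?_ ?_ ?_
  · rintro ⟨c, a, b⟩ - ⟨c', a', b'⟩ - h
    simpa using h
  · rintro ⟨c, a, b⟩ h
    simp at h ⊢
    omega
  · rintro ⟨c, a, b⟩ h h'
    rcases c with _ | c
    -- Terms with c = 0 do not involve j, so they cancel.
    · simp [summand]
    · exact absurd ⟨(c, a, b), by simp at h ⊢; omega, rfl⟩ h'
  · rintro ⟨c, a, b⟩ -
    simp only [summand]
    rw [← invDen_succ_one c a b, expo_succ_right]
    ring

theorem tripleSum_sub_two (i k j m : ℕ) :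
    tripleSum i k j (m + 2) - tripleSum (i + 6) k j (m + 2) =
      q ^ (i + 5) * tripleSum (i + 12) (k + 12) (j + 6) m := by
  rw [tripleSum, tripleSum, tripleSum, ← Finset.sum_sub_distrib, Finset.mul_sum]
  symm
  refine Finset.sum_of_injOn (fun t => (t.1, t.2.1 + 1, t.2.2)) ?_ ?_ ?_ ?_
  · rintro ⟨c, a, b⟩ - ⟨c', a', b'⟩ - h
    simpa using h
  · rintro ⟨c, a, b⟩ h
    simp at h ⊢
    omega
  · rintro ⟨c, a, b⟩ h h'
    rcases a with _ | a
    · simp [summand]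
    · exact absurd ⟨(c, a, b), by simp at h ⊢; omega, rfl⟩ h'
  · rintro ⟨c, a, b⟩ -
    simp only [summand]
    rw [← invDen_succ_two c a b, expo_succ_left]
    ring

theorem tripleSum_sub_three (i k j m : ℕ) :
    tripleSum i k j (m + 2) - tripleSum i (k + 6) j (m + 2) =
      q ^ (k + 7) * tripleSum (i + 12) (k + 12) (j + 6) m := by
  rw [tripleSum, tripleSum, tripleSum, ← Finset.sum_sub_distrib, Finset.mul_sum]
  symm
  refine Finset.sum_of_injOn (fun t => (t.1, t.2.1, t.2.2 + 1)) ?_ ?_ ?_ ?_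
  · rintro ⟨c, a, b⟩ - ⟨c', a', b'⟩ - h
    simpa using h
  · rintro ⟨c, a, b⟩ h
    simp at h ⊢
    omega
  · rintro ⟨c, a, b⟩ h h'
    rcases b with _ | b
    · simp [summand]
    · exact absurd ⟨(c, a, b), by simp at h ⊢; omega, rfl⟩ h'
  · rintro ⟨c, a, b⟩ -
    simp only [summand]
    rw [← invDen_succ_three c a b, expo_succ_mid]
    ring

theorem tripleSum_zero (i k j : ℕ) : tripleSum i k j 0 = 1 := by
  have h : triples 0 = {(0, 0, 0)} := by
    ext ⟨c, a, b⟩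
    simp
    omega
  simp [tripleSum, h, summand, expo, invDen, poch]

theorem tripleSum_one (i k i' k' j : ℕ) : tripleSum i k j 1 = tripleSum i' k' j 1 := by
  have h : triples 1 = {(1, 0, 0)} := by
    ext ⟨c, a, b⟩
    simp
    omega
  simp [tripleSum, h, summand]

/-- The weighted triple series that counts the partitions with all parts greater than `k`. -/
def tailSum (k m : ℕ) : Series :=
  -- From k to k + 1 the weight of c grows by 1; that of a grows by 6 when k ≡ 0 mod 3, that of b by
  -- 6 when k ≡ 1.
  tripleSum (6 * ((k + 2) / 3)) (6 * ((k + 1) / 3)) k m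

/-- The bound that the other parts of a partition must exceed, once its smallest part is `k + 1`. -/
def nextBound (k : ℕ) : ℕ :=
  if 3 ∣ k + 1 then k + 4 else k + 3

theorem tailSum_succ (k m : ℕ) :
    tailSum k (m + 1) = tailSum (k + 1) (m + 1) + q ^ (k + 1) * tailSum (nextBound k) m := by
  -- One part leaves no room for a or b, and the equations in a and b need two.
  rcases m with _ | m
  · have h := tripleSum_sub_one 0 0 k 0
    simp only [tailSum, zero_add, tripleSum_zero] at h ⊢
    rw [tripleSum_one _ _ 0 0, tripleSum_one (6 * ((k + 1 + 2) / 3)) _ 0 0, ← h]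
    ring
  · obtain ⟨r, rfl | rfl | rfl⟩ : ∃ r, k = 3 * r ∨ k = 3 * r + 1 ∨ k = 3 * r + 2 :=
      ⟨k / 3, by omega⟩
    · have h1 := tripleSum_sub_one (6 * r) (6 * r) (3 * r) (m + 1)
      have h2 := tripleSum_sub_two (6 * r) (6 * r) (3 * r + 1) m
      have h3 := tripleSum_sub_one (6 * r + 6) (6 * r + 6) (3 * r + 3) m
      rw [nextBound, if_neg (by omega)]
      simp only [tailSum]
      rw [show 6 * ((3 * r + 2) / 3) = 6 * r by omega, show 6 * ((3 * r + 1) / 3) = 6 * r by omega,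
        show 6 * ((3 * r + 1 + 2) / 3) = 6 * r + 6 by omega,
        show 6 * ((3 * r + 3 + 2) / 3) = 6 * r + 6 by omega,
        show 6 * ((3 * r + 3 + 1) / 3) = 6 * r + 6 by omega]
      -- The right side of `h2` is q^(3r+1) times that of `h3`, so it turns the weight 3r + 4 left
      -- by `h1` into 3r + 3.
      linear_combination h1 + h2 - q ^ (3 * r + 1) * h3
    · have h1 := tripleSum_sub_one (6 * r + 6) (6 * r) (3 * r + 1) (m + 1)
      have h2 := tripleSum_sub_three (6 * r + 6) (6 * r) (3 * r + 2) m
      have h3 := tripleSum_sub_one (6 * r + 12) (6 * r + 6) (3 * r + 4) m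
      rw [nextBound, if_neg (by omega)]
      simp only [tailSum]
      rw [show 6 * ((3 * r + 1 + 2) / 3) = 6 * r + 6 by omega,
        show 6 * ((3 * r + 1 + 1) / 3) = 6 * r by omega,
        show 6 * ((3 * r + 1 + 1 + 2) / 3) = 6 * r + 6 by omega,
        show 6 * ((3 * r + 1 + 3 + 2) / 3) = 6 * r + 12 by omega,
        show 6 * ((3 * r + 1 + 3 + 1) / 3) = 6 * r + 6 by omega]
      linear_combination h1 + h2 - q ^ (3 * r + 2) * h3
    · have h1 := tripleSum_sub_one (6 * r + 6) (6 * r + 6) (3 * r + 2) (m + 1)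
      rw [nextBound, if_pos (by omega)]
      simp only [tailSum]
      rw [show 6 * ((3 * r + 2 + 2) / 3) = 6 * r + 6 by omega,
        show 6 * ((3 * r + 2 + 1) / 3) = 6 * r + 6 by omega,
        show 6 * ((3 * r + 2 + 1 + 2) / 3) = 6 * r + 6 by omega,
        show 6 * ((3 * r + 2 + 4 + 2) / 3) = 6 * r + 12 by omega,
        show 6 * ((3 * r + 2 + 4 + 1) / 3) = 6 * r + 12 by omega]
      linear_combination h1

theorem pow_dvd_tailSum (k m : ℕ) : q ^ k ∣ tailSum (k + 2) (m + 1) := by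
  refine Finset.dvd_sum fun ⟨c, a, b⟩ h => Dvd.dvd.mul_right (pow_dvd_pow q ?_) _
  rw [mem_triples] at h
  dsimp only at h ⊢
  have h1 : k ≤ 6 * ((k + 2 + 2) / 3) := by omega
  have h2 : k ≤ 6 * ((k + 2 + 1) / 3) := by omega
  obtain ha | hb | hc : 1 ≤ a ∨ 1 ≤ b ∨ 1 ≤ c := by omega
  · nlinarith [Nat.mul_le_mul h1 ha]
  · nlinarith [Nat.mul_le_mul h2 hb]
  · nlinarith

/-! ### Removing the smallest part -/

theorem Compatible.symm {a b : ℕ} (h : Compatible a b) : Compatible b a := by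
  unfold Compatible at *
  rw [abs_sub_comm]
  exact ⟨h.1, fun hb ha => h.2 ha hb⟩

theorem pairwise_compatible_cons {a : ℕ} {M : Multiset ℕ} :
    (a ::ₘ M).Pairwise Compatible ↔ (∀ b ∈ M, Compatible a b) ∧ M.Pairwise Compatible := by
  have hs : Std.Symm Compatible := ⟨fun _ _ => Compatible.symm⟩
  induction M using Quotient.inductionOn with
  | h l =>
    rw [Multiset.quot_mk_to_coe, Multiset.cons_coe, Multiset.pairwise_coe_iff_pairwise,
      Multiset.pairwise_coe_iff_pairwise, List.pairwise_cons]
    rfl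

/-- When 3 ∣ k + 1, the value k + 4 is a multiple of 3 only 3 away, hence excluded; beyond it the
next multiple is already 6 away. -/
theorem nextBound_lt_iff {k a : ℕ} : nextBound k < a ↔ k < a ∧ Compatible (k + 1) a := by
  unfold nextBound Compatible
  rw [le_abs, le_abs]
  push_cast
  split_ifs <;> omega

/-- The multisets of `m` pairwise compatible parts greater than `k` whose sum is `n`. -/
def tails (k m n : ℕ) : Set (Multiset ℕ) :=
  {M | M.card = m ∧ M.sum = n ∧ M.Pairwise Compatible ∧ ∀ a ∈ M, k < a}

/-- The partitions counted by `s m n` as multisets. -/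
def partitionsEquivTails (m n : ℕ) :
    {p : n.Partition // p.parts.card = m ∧ IsSchur p} ≃ tails 0 m n where
  toFun p := ⟨p.1.parts, p.2.1, p.1.parts_sum, p.2.2, fun _ => p.1.parts_pos⟩
  invFun M := ⟨⟨M.1, fun h => M.2.2.2.2 _ h, M.2.2.1⟩, M.2.1, M.2.2.2.1⟩
  left_inv _ := rfl
  right_inv _ := rfl

theorem s_eq_ncard (m n : ℕ) : s m n = (tails 0 m n).ncard := by
  rw [← Nat.card_coe_set_eq]
  exact Nat.card_congr (partitionsEquivTails m n)

theorem finite_tails (k m n : ℕ) : (tails k m n).Finite := by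
  have h : (tails 0 m n).Finite := Set.finite_coe_iff.1 (Finite.of_equiv _ (partitionsEquivTails m n))
  exact h.subset fun M hM => ⟨hM.1, hM.2.1, hM.2.2.1, fun a ha => (hM.2.2.2 a ha).pos⟩

theorem tails_zero_parts (k n : ℕ) : tails k 0 n = if n = 0 then {0} else ∅ := by
  ext M
  simp only [tails, Multiset.card_eq_zero, Set.mem_ofPred_eq]
  split_ifs with h
  · subst h
    constructor
    · exact fun h => h.1
    · rintro rfl
      simp
  · simp only [Set.mem_empty_iff_false, iff_false]
    rintro ⟨rfl, h', -⟩
    exact h (by simpa using h'.symm)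

theorem tails_eq_empty {k m n : ℕ} (h : n ≤ k) : tails k (m + 1) n = ∅ := by
  refine Set.eq_empty_of_forall_notMem fun M hM => ?_
  obtain ⟨a, ha⟩ := Multiset.card_pos_iff_exists_mem.1 (by rw [hM.1]; exact m.succ_pos)
  have h1 := Multiset.le_sum_of_mem ha
  have h2 := hM.2.2.2 a ha
  have h3 := hM.2.1
  omega

theorem tails_succ_add (k m n : ℕ) :
    tails k (m + 1) (n + (k + 1)) =
      tails (k + 1) (m + 1) (n + (k + 1)) ∪ (Multiset.cons (k + 1)) '' tails (nextBound k) m n := by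
  ext M
  constructor
  · intro hM
    by_cases hk : k + 1 ∈ M
    · right
      obtain ⟨M, rfl⟩ := Multiset.exists_cons_of_mem hk
      obtain ⟨h1, h2, h3, h4⟩ := hM
      rw [pairwise_compatible_cons] at h3
      refine ⟨M, ⟨by simpa using h1, by simp at h2; omega, h3.2, fun a ha => ?_⟩, rfl⟩
      exact nextBound_lt_iff.2 ⟨h4 a (Multiset.mem_cons_of_mem ha), h3.1 a ha⟩
    · left
      refine ⟨hM.1, hM.2.1, hM.2.2.1, fun a ha => lt_of_le_of_ne (hM.2.2.2 a ha) ?_⟩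
      rintro rfl
      exact hk ha
  · rintro (hM | ⟨M, ⟨h1, h2, h3, h4⟩, rfl⟩)
    · exact ⟨hM.1, hM.2.1, hM.2.2.1, fun a ha => (Nat.lt_succ_self k).trans (hM.2.2.2 a ha)⟩
    · refine ⟨by simp [h1], by simp [h2]; omega, ?_, fun a ha => ?_⟩
      · exact pairwise_compatible_cons.2 ⟨fun b hb => (nextBound_lt_iff.1 (h4 b hb)).2, h3⟩
      · obtain rfl | ha := Multiset.mem_cons.1 ha
        · omega
        · exact (nextBound_lt_iff.1 (h4 a ha)).1

theorem ncard_tails_succ_add (k m n : ℕ) :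
    (tails k (m + 1) (n + (k + 1))).ncard =
      (tails (k + 1) (m + 1) (n + (k + 1))).ncard + (tails (nextBound k) m n).ncard := by
  rw [tails_succ_add, Set.ncard_union_eq ?_ (finite_tails _ _ _) ((finite_tails _ _ _).image _),
    Set.ncard_image_of_injective _ fun _ _ => (Multiset.cons_inj_right _).1]
  rw [Set.disjoint_left]
  rintro _ hM ⟨M, -, rfl⟩
  exact lt_irrefl _ (hM.2.2.2 _ (Multiset.mem_cons_self _ _))

/-! ### Generating functions of the tails -/

theorem summable_of_finite_coeff {ι : Type*} {f : ι → Series}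
    (h : ∀ d, {t | MvPowerSeries.coeff d (f t) ≠ 0}.Finite) : Summable f :=
  MvPowerSeries.WithPiTopology.summable_iff_summable_coeff.2 fun d =>
    summable_of_hasFiniteSupport (h d)

theorem coeff_eq_zero_of_dvd {f : Series} {i : Fin 2} {n : ℕ} (h : MvPowerSeries.X i ^ n ∣ f)
    {d : Fin 2 →₀ ℕ} (hd : d i < n) : MvPowerSeries.coeff d f = 0 :=
  MvPowerSeries.X_pow_dvd_iff.1 h d hd

theorem summable_mul_q_pow (f : ℕ → Series) : Summable fun n => f n * q ^ n := by
  refine summable_of_finite_coeff fun d => (Set.finite_Iic (d 1)).subset fun n hn => ?_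
  by_contra h
  exact hn (coeff_eq_zero_of_dvd (Dvd.intro_left _ rfl) (not_le.1 h))

/-- The generating function of the partitions into `m` compatible parts greater than `k`. -/
def tailGen (k m : ℕ) : Series :=
  ∑' n, ((tails k m n).ncard : Series) * q ^ n

theorem tailGen_zero (k : ℕ) : tailGen k 0 = 1 := by
  rw [tailGen, tsum_eq_single 0]
  · simp [tails_zero_parts]
  · intro n hn
    simp [tails_zero_parts, hn]

theorem tailGen_succ_eq (k l m : ℕ) (h : l ≤ k + 1) :
    tailGen k (m + 1) = q ^ l * ∑' n, ((tails k (m + 1) (n + l)).ncard : Series) * q ^ n := by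
  rw [← (summable_mul_q_pow _).tsum_mul_left, tailGen,
    ← (add_left_injective l).tsum_eq]
  · exact tsum_congr fun n => by ring
  · intro n hn
    refine ⟨n - l, Nat.sub_add_cancel ?_⟩
    by_contra hl
    refine hn ?_
    simp [tails_eq_empty (show n ≤ k by omega)]

theorem tailGen_succ (k m : ℕ) :
    tailGen k (m + 1) = tailGen (k + 1) (m + 1) + q ^ (k + 1) * tailGen (nextBound k) m := by
  rw [tailGen_succ_eq k (k + 1) m le_rfl, tailGen_succ_eq (k + 1) (k + 1) m (by omega), ← mul_add,
    tailGen, ← (summable_mul_q_pow _).tsum_add (summable_mul_q_pow _)]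
  simp only [ncard_tails_succ_add, Nat.cast_add, add_mul]

theorem pow_dvd_tailGen (k m : ℕ) : q ^ k ∣ tailGen k (m + 1) :=
  Dvd.intro _ (tailGen_succ_eq k k m (by omega)).symm

theorem eq_zero_of_forall_q_pow_dvd {f : Series} (h : ∀ n, q ^ n ∣ f) : f = 0 :=
  MvPowerSeries.ext fun d => coeff_eq_zero_of_dvd (h (d 1 + 1)) (Nat.lt_succ_self _)

theorem tailGen_eq_tailSum (m : ℕ) : ∀ k, tailGen k m = tailSum k m := by
  induction m with
  | zero => exact fun k => (tailGen_zero k).trans (tripleSum_zero _ _ _).symm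
  | succ m ih =>
    intro k
    have hstep : ∀ r, tailGen k (m + 1) - tailSum k (m + 1) =
        tailGen (k + r) (m + 1) - tailSum (k + r) (m + 1) := by
      intro r
      induction r with
      | zero => rfl
      | succ r ihr =>
        rw [ihr, tailGen_succ, tailSum_succ, ih]
        ring_nf
    refine sub_eq_zero.1 (eq_zero_of_forall_q_pow_dvd fun n => ?_)
    -- The offset 2 is the one in `pow_dvd_tailSum`.
    rw [hstep (n + 2)]
    refine dvd_sub ((pow_dvd_pow q ?_).trans (pow_dvd_tailGen _ _))
      ((pow_dvd_pow q ?_).trans (pow_dvd_tailSum (k + n) m)) <;> omega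

/-! ### Summability and summation over the number of parts -/

theorem term_eq (t : ℕ × ℕ × ℕ) :
    term t.1 t.2.1 t.2.2 = x ^ (2 * t.2.1 + 2 * t.2.2 + t.1) * summand 0 0 0 t := by
  simp only [term, summand, invDen, zero_mul, add_zero]
  ring

theorem summable_term : Summable fun t : ℕ × ℕ × ℕ => term t.1 t.2.1 t.2.2 := by
  refine summable_of_finite_coeff fun d =>
    ((Finset.range (d 0 + 1)).biUnion triples).finite_toSet.subset fun t ht => ?_
  by_contra h
  refine ht (coeff_eq_zero_of_dvd (i := 0) (Dvd.intro _ (term_eq t).symm) ?_)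
  simpa using h

theorem summable_partitions :
    Summable fun t : ℕ × ℕ => (s t.1 t.2 : Series) * x ^ t.1 * q ^ t.2 := by
  refine summable_of_finite_coeff fun d =>
    ((Set.finite_Iic (d 0)).prod (Set.finite_Iic (d 1))).subset fun t ht => ?_
  refine ⟨?_, ?_⟩ <;> by_contra h <;> refine ht ?_
  · exact coeff_eq_zero_of_dvd (i := 0) (n := t.1)
      (Dvd.dvd.mul_right (Dvd.intro_left _ rfl) _) (not_le.1 h)
  · exact coeff_eq_zero_of_dvd (i := 1) (n := t.2) (Dvd.intro_left _ rfl) (not_le.1 h)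

theorem tsum_partitions :
    ∑' t : ℕ × ℕ, (s t.1 t.2 : Series) * x ^ t.1 * q ^ t.2 = ∑' m, x ^ m * tailGen 0 m := by
  have h : ∀ m, (fun n => (s m n : Series) * x ^ m * q ^ n) =
      fun n => x ^ m * (((tails 0 m n).ncard : Series) * q ^ n) := fun m => by
    funext n
    rw [s_eq_ncard]
    ring
  rw [summable_partitions.tsum_prod' fun m => summable_mul_q_pow _]
  refine tsum_congr fun m => ?_
  rw [h, (summable_mul_q_pow _).tsum_mul_left, tailGen]

theorem hasSum_term_fiber (m : ℕ) :
    HasSum (fun t : {t : ℕ × ℕ × ℕ // 2 * t.2.1 + 2 * t.2.2 + t.1 = m} =>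
      term t.1.1 t.1.2.1 t.1.2.2) (x ^ m * tailSum 0 m) := by
  let _ : Fintype {t : ℕ × ℕ × ℕ // 2 * t.2.1 + 2 * t.2.2 + t.1 = m} :=
    Fintype.subtype (triples m) fun _ => mem_triples
  have hsum : x ^ m * tailSum 0 m = ∑ t ∈ triples m, term t.1 t.2.1 t.2.2 := by
    rw [tailSum, tripleSum, Finset.mul_sum]
    refine Finset.sum_congr rfl fun t ht => ?_
    rw [term_eq, mem_triples.1 ht]
  rw [hsum, Finset.sum_subtype (triples m) (fun _ => mem_triples)
    fun t : ℕ × ℕ × ℕ => term t.1 t.2.1 t.2.2]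
  exact hasSum_fintype _

theorem tsum_term :
    ∑' t : ℕ × ℕ × ℕ, term t.1 t.2.1 t.2.2 = ∑' m, x ^ m * tailSum 0 m := by
  rw [← (Equiv.sigmaFiberEquiv fun t : ℕ × ℕ × ℕ => 2 * t.2.1 + 2 * t.2.2 + t.1).tsum_eq
    fun t : ℕ × ℕ × ℕ => term t.1 t.2.1 t.2.2]
  have hs := (Equiv.sigmaFiberEquiv fun t : ℕ × ℕ × ℕ =>
    2 * t.2.1 + 2 * t.2.2 + t.1).summable_iff.2 summable_term
  refine (Summable.tsum_sigma' (fun m => (hasSum_term_fiber m).summable) hs).trans ?_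
  exact tsum_congr fun m => (hasSum_term_fiber m).tsum_eq

end SchurSeries

end

theorem mainTheorem1 :
    Summable (fun t : ℕ × ℕ =>
      (SchurSeries.s t.1 t.2 : SchurSeries.Series) *
        SchurSeries.x ^ t.1 * SchurSeries.q ^ t.2) ∧
    Summable (fun t : ℕ × ℕ × ℕ => SchurSeries.term t.1 t.2.1 t.2.2) ∧
    ∑' t : ℕ × ℕ, (SchurSeries.s t.1 t.2 : SchurSeries.Series) *
        SchurSeries.x ^ t.1 * SchurSeries.q ^ t.2
      = ∑' t : ℕ × ℕ × ℕ, SchurSeries.term t.1 t.2.1 t.2.2 := by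
  refine ⟨SchurSeries.summable_partitions, SchurSeries.summable_term, ?_⟩
  rw [SchurSeries.tsum_partitions, SchurSeries.tsum_term]
  simp only [SchurSeries.tailGen_eq_tailSum]
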